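/- **Setting.** Let $K$ be a field and let $[X]$ be a commutative cancellative monoid of power-products in which $1$ is the only invertible element, any two elements have a least common multiple, and which admits a Dickson grading, i.e. a map $d:[X]\to\mathbb N$ with $d(st)=\max(d(s),d(t))$ such that for every $m$ and every sequence $(s_i)_{i\in\mathbb N}$ with $d(s_i)\le m$ there are $i<j$ with $s_i\mid s_j$. (This covers the power-products in finitely or countably many indeterminates.) Let $K[X]$ be the monoid algebra of $[X]$ over $K$, let $\kappa\neq\emptyset$ be a well-ordered index set (e.g. $\kappa=\{0,\dots,k-1\}$ with $k\ge 1$), and let $K[X]^{\kappa}$ be the free $K[X]$-module with basis $(e_i)_{i\in\kappa}$ (so $K[X]^{\kappa}=K[x_0,\dots,x_{n-1}]^k$ in the classical case). Fix a linear order $\preceq$ on $[X]$ with least element $1$ such that $s\preceq t$ implies $su\preceq tu$, and a linear order $\preceq_{\mathsf t}$ on the terms $t\,e_i$ ($t\in[X]$, $i\in\kappa$) such that $s\,e_i\preceq_{\mathsf t}t\,e_j$ implies $us\,e_i\preceq_{\mathsf t}ut\,e_j$, and $s\preceq t$, $i\le j$ imply $s\,e_i\preceq_{\mathsf t}t\,e_j$.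 For $p\ne0$ let $\mathrm{lt}(p)$ be the $\preceq_{\mathsf t}$-largest term of $p$ and $\mathrm{lc}(p)$ its coefficient; $\mathrm{pmdl}(B)$ is the submodule generated by $B$; a term $s\,e_i$ divides $t\,e_j$ iff $i=j$ and $s\mid t$. For a set $F$, $p\to_F q$ means that there are $0\ne f\in F$ with $\mathrm{lt}(f)=s\,e_j$ and $t\in[X]$ such that the coefficient $c$ of $ts\,e_j$ in $p$ is non-zero and $q=p-\frac{c}{\mathrm{lc}(f)}\,t f$. A set $G$ is a *Gröbner basis* if $\to_G$ is confluent. It is a *reduced Gröbner basis* if moreover no $b\in G$ is reducible modulo $G\setminus\{b\}$, $\mathrm{lc}(b)=1$ for all $b\in G$, and $0\notin G$. For a finite list $fs$, $\mathrm{trd}(fs,p)$ is the total reduction of $p$: its terms are processed in descending order, and each one is cancelled using the first non-zero $f$ in $fs$ whose leading term divides it, or else moved to the result. For a finite list $xs$, $\mathrm{comp\_red\_monic\_basis}(xs)$ is computed as follows: (1) remove all zeros and then, going through the list, every element whose leading term is divisible by the leading term of another element still present; (2) going through the list, replace every element $x$ by $\mathrm{trd}(fs,x)$, where $fs$ is the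 list of all other current elements; (3) divide every element by its leading coefficient. **Theorem.** 1. If $A,B\subseteq K[X]^{\kappa}$ are reduced Gröbner bases with $\mathrm{pmdl}(A)=\mathrm{pmdl}(B)$, then $A=B$. 2. If $xs$ is a finite list whose set of elements is a Gröbner basis, then the set of elements of $\mathrm{comp\_red\_monic\_basis}(xs)$ is a reduced Gröbner basis, and it generates the same submodule as $xs$. 3. For every finitely generated submodule $N$ of $K[X]^{\kappa}$ there is exactly one reduced Gröbner basis $G$ with $\mathrm{pmdl}(G)=N$. -/

import Mathlib

/-!
Gröbner bases of submodules of free modules over polynomial rings.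

Power-products are written additively: the monoid operation of `α` is `+`, the power-product `1`
is `0`, and divisibility of power-products is `Adds`.  For `α = (σ →₀ ℕ)` the ring
`AddMonoidAlgebra K α` is `MvPolynomial σ K`.
-/

noncomputable section

namespace ModuleGB

/-! ### Power-products -/

/-- Divisibility of (additively written) power-products. -/
def Adds {α : Type*} [Add α] (s t : α) : Prop := ∃ u, t = s + u

/-- `d` is a Dickson grading: it turns products into maxima, and below every bound divisibility of
power-products is almost full (every sequence `s` has `i < j` with `s i` dividing `s j`). -/
structure IsDicksonGrading {α : Type*} [Add α] (d : α → ℕ) : Prop where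
  map_add : ∀ s t, d (s + t) = max (d s) (d t)
  dickson : ∀ n : ℕ, {t | d t ≤ n}.PartiallyWellOrderedOn Adds

/-- Cancellative commutative monoids of power-products: `0` (the power-product `1`) is the only
invertible element, least common multiples exist, and there is a Dickson grading. -/
class GradedDicksonPowerprod (α : Type*) [AddCommMonoid α] : Prop extends IsCancelAdd α where
  eq_zero_of_add : ∀ s t : α, s + t = 0 → s = 0
  exists_lcm : ∀ s t : α, ∃ l, Adds s l ∧ Adds t l ∧ ∀ u, Adds s u → Adds t u → Adds l u
  exists_grading : ∃ d : α → ℕ, IsDicksonGrading d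

/-- The power-products in finitely or countably many indeterminates. -/
instance {σ : Type*} [Countable σ] : GradedDicksonPowerprod (σ →₀ ℕ) where
  eq_zero_of_add s t h := by
    ext i
    have := DFunLike.congr_fun h i
    simp at this
    simp [this.1]
  exists_lcm s t := by
    have key : ∀ a b : σ →₀ ℕ, Adds a b ↔ a ≤ b := fun a b => le_iff_exists_add.symm
    refine ⟨s ⊔ t, (key _ _).2 le_sup_left, (key _ _).2 le_sup_right, fun u hs ht => ?_⟩
    exact (key _ _).2 (sup_le ((key _ _).1 hs) ((key _ _).1 ht))
  exists_grading := by
    classical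
    obtain ⟨e, he⟩ := exists_injective_nat σ
    refine ⟨fun t => t.support.sup fun i => e i + 1, ?_, ?_⟩
    · intro s t
      have : (s + t).support = s.support ∪ t.support := by
        ext i
        simp only [Finsupp.mem_support_iff, Finsupp.add_apply, Finset.mem_union]
        omega
      change (s + t).support.sup _ = _
      rw [this, Finset.sup_union]
    · intro n f
      have hfin : Finite {i : σ // e i + 1 ≤ n} :=
        Finite.of_injective (β := Fin n) (fun i => ⟨e i.1, i.2⟩) fun i j h => by
          apply Subtype.ext
          apply he
          simpa using h
      obtain ⟨i, j, hij, hle⟩ := wellQuasiOrdered_le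
        (fun k (a : {i : σ // e i + 1 ≤ n}) => (f k).1 a.1)
      refine ⟨i, j, hij, le_iff_exists_add.1 fun a => ?_⟩
      by_cases ha : e a + 1 ≤ n
      · exact hle ⟨a, ha⟩
      · have hz : (f i).1 a = 0 := by
          by_contra hne
          apply ha
          have h1 : ((f i).1.support.sup fun i => e i + 1) ≤ n := (f i).2
          exact (Finset.le_sup (f := fun i => e i + 1) (Finsupp.mem_support_iff.2 hne)).trans h1
        rw [hz]
        exact Nat.zero_le _

/-! ### Term orders -/

/-- An admissible order `ordP` on the power-products together with an admissible extension `ordT`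
to the terms `t e_i`, which are represented as pairs `(t, i)`. -/
structure TermOrder (α κ : Type*) [AddMonoid α] [LE κ] where
  ordP : LinearOrder α
  ordT : LinearOrder (α × κ)
  zero_min : ∀ t, ordP.le 0 t
  add_mono : ∀ s t u, ordP.le s t → ordP.le (s + u) (t + u)
  stimes_mono : ∀ (v w : α × κ) (t : α), ordT.le v w → ordT.le (t + v.1, v.2) (t + w.1, w.2)
  ord_termI : ∀ v w : α × κ, ordP.le v.1 w.1 → v.2 ≤ w.2 → ordT.le v w

/-! ### Vector-polynomials -/

/-- The free module with basis `e_i` (`i : κ`) over the polynomial ring with power-products `α`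
and coefficients `K`. For `α = (Fin n →₀ ℕ)` and `κ = Fin k` this is `K[x_0, …, x_{n-1}]^k`. -/
abbrev VecPoly (α κ K : Type*) [Semiring K] : Type _ := κ →₀ AddMonoidAlgebra K α

section Basic

variable {α κ K : Type*} [AddCommMonoid α] [Field K]

/-- The coefficient of the term `v` in `p`. -/
def coeff (p : VecPoly α κ K) (v : α × κ) : K := (p v.2).coeff v.1

open scoped Classical in
/-- The finite set of terms that appear in `p` with non-zero coefficient. -/
def keys (p : VecPoly α κ K) : Finset (α × κ) :=
  p.support.biUnion fun i => (p i).coeff.support.image fun t => (t, i)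

theorem mem_keys {p : VecPoly α κ K} {v : α × κ} : v ∈ keys p ↔ coeff p v ≠ 0 := by
  classical
  obtain ⟨t, i⟩ := v
  simp only [keys, coeff, Finset.mem_biUnion, Finset.mem_image, Finsupp.mem_support_iff]
  constructor
  · rintro ⟨j, hj, s, hs, h⟩
    obtain ⟨rfl, rfl⟩ := Prod.mk.inj h
    exact hs
  · intro h
    refine ⟨i, fun h0 => h ?_, t, h, rfl⟩
    simp [h0]

theorem ext_coeff {p q : VecPoly α κ K} (h : ∀ v, coeff p v = coeff q v) : p = q := by
  ext i t
  exact h (t, i)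

theorem keys_nonempty {p : VecPoly α κ K} (hp : p ≠ 0) : (keys p).Nonempty := by
  by_contra h
  apply hp
  apply ext_coeff
  intro v
  by_contra hv
  exact h ⟨v, mem_keys.2 hv⟩

/-- The scalar multiple `c · v` of a term `v`. -/
def monomial (c : K) (v : α × κ) : VecPoly α κ K :=
  Finsupp.single v.2 (AddMonoidAlgebra.single v.1 c)

/-- Multiplication of `p` by the coefficient `c` and the power-product `t`. -/
def monomMult (c : K) (t : α) (p : VecPoly α κ K) : VecPoly α κ K :=
  AddMonoidAlgebra.single t c • p

/-- A term `s e_i` divides a term `t e_j` iff `i = j` and `s` divides `t`. -/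
def TermDvd (v w : α × κ) : Prop := v.2 = w.2 ∧ Adds v.1 w.1

open scoped Classical in
/-- The quotient `t / s` of power-products (if `s` divides `t`). -/
def quot (t s : α) : α := if h : Adds s t then h.choose else 0

theorem quot_spec {s t : α} (h : Adds s t) : quot t s + s = t := by
  rw [quot, dif_pos h, add_comm]
  exact h.choose_spec.symm

theorem coeff_sub (p q : VecPoly α κ K) (v : α × κ) :
    coeff (p - q) v = coeff p v - coeff q v := by
  simp [coeff]

theorem coeff_monomial_self (c : K) (v : α × κ) : coeff (monomial c v) v = c := by
  simp [coeff, monomial]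

theorem coeff_monomial_ne (c : K) {v w : α × κ} (h : v ≠ w) : coeff (monomial c v) w = 0 := by
  classical
  obtain ⟨s, i⟩ := v
  obtain ⟨t, j⟩ := w
  by_cases hij : i = j
  · subst hij
    have hst : s ≠ t := fun e => h (by rw [e])
    simp [coeff, monomial, hst]
  · simp [coeff, monomial, hij]

theorem coeff_monomMult [IsCancelAdd α] (c : K) (t : α) (p : VecPoly α κ K) (v : α × κ) :
    coeff (monomMult c t p) (t + v.1, v.2) = c * coeff p v := by
  simp only [coeff, monomMult, Finsupp.smul_apply, smul_eq_mul]
  exact AddMonoidAlgebra.coeff_single_mul_add (p v.2) c t v.1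

theorem exists_of_coeff_monomMult [IsCancelAdd α] {c : K} {t : α} {p : VecPoly α κ K}
    {w : α × κ}
    (h : coeff (monomMult c t p) w ≠ 0) : ∃ v, w = (t + v.1, v.2) ∧ coeff p v ≠ 0 := by
  by_cases ht : ∃ u, w.1 = t + u
  · obtain ⟨u, hu⟩ := ht
    have hw : w = (t + u, w.2) := Prod.ext hu rfl
    refine ⟨(u, w.2), hw, fun h0 => h ?_⟩
    rw [hw]
    have := coeff_monomMult c t p (u, w.2)
    simp only [h0, mul_zero] at this
    exact this
  · exfalso
    apply h
    simp only [coeff, monomMult, Finsupp.smul_apply, smul_eq_mul]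
    exact AddMonoidAlgebra.coeff_single_mul_of_forall_add_ne c (p w.2)
      fun d hd => ht ⟨d, hd.symm⟩

end Basic

namespace TermOrder

variable {α κ K : Type*} [AddCommMonoid α] [LinearOrder κ] [Nonempty κ] [Field K]

open scoped Classical in
/-- The leading term of `p` (an irrelevant default value for `p = 0`). -/
def lt (o : TermOrder α κ) (p : VecPoly α κ K) : α × κ :=
  if h : (keys p).Nonempty then @Finset.max' _ o.ordT (keys p) h
  else (0, Classical.arbitrary κ)

/-- The leading coefficient of `p`. -/
def lc (o : TermOrder α κ) (p : VecPoly α κ K) : K := coeff p (o.lt p)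

/-- `p` without its leading monomial. -/
def tail (o : TermOrder α κ) (p : VecPoly α κ K) : VecPoly α κ K :=
  p - monomial (o.lc p) (o.lt p)

/-- `p` divided by its leading coefficient. -/
def monic (o : TermOrder α κ) (p : VecPoly α κ K) : VecPoly α κ K := monomMult (1 / o.lc p) 0 p

/-! ### Reduction and Gröbner bases -/

/-- `p` reduces to `q` modulo the single vector-polynomial `f` using the power-product `t`. -/
def RedSingle (o : TermOrder α κ) (p q f : VecPoly α κ K) (t : α) : Prop :=
  f ≠ 0 ∧ coeff p (t + (o.lt f).1, (o.lt f).2) ≠ 0 ∧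
    q = p - monomMult (coeff p (t + (o.lt f).1, (o.lt f).2) / o.lc f) t f

/-- The (one-step) reduction relation modulo the set `F`. -/
def Red (o : TermOrder α κ) (F : Set (VecPoly α κ K)) (p q : VecPoly α κ K) : Prop :=
  ∃ f ∈ F, ∃ t, o.RedSingle p q f t

/-- `p` is reducible modulo `F`. -/
def IsRed (o : TermOrder α κ) (F : Set (VecPoly α κ K)) (p : VecPoly α κ K) : Prop :=
  ∃ q, o.Red F p q

/-- `G` is a Gröbner basis: the reduction relation modulo `G` is confluent. -/
def IsGroebnerBasis (o : TermOrder α κ) (G : Set (VecPoly α κ K)) : Prop :=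
  ∀ p q r, Relation.ReflTransGen (o.Red G) p q → Relation.ReflTransGen (o.Red G) p r →
    Relation.Join (Relation.ReflTransGen (o.Red G)) q r

/-- No element of `B` can be reduced modulo the other elements of `B`. -/
def IsAutoReduced (o : TermOrder α κ) (B : Set (VecPoly α κ K)) : Prop :=
  ∀ b ∈ B, ¬ o.IsRed (B \ {b}) b

/-- Auto-reduced Gröbner bases of non-zero monic vector-polynomials. -/
structure IsReducedGB (o : TermOrder α κ) (B : Set (VecPoly α κ K)) : Prop where
  isGroebnerBasis : o.IsGroebnerBasis B
  isAutoReduced : o.IsAutoReduced B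
  monic : ∀ b ∈ B, o.lc b = 1
  zero_notMem : (0 : VecPoly α κ K) ∉ B

/-! ### Total reduction -/

open scoped Classical in
/-- The first non-zero element of `fs` whose leading term divides `v` (if any). -/
def findDvd (o : TermOrder α κ) (fs : List (VecPoly α κ K)) (v : α × κ) :
    Option (VecPoly α κ K) :=
  fs.find? fun f => decide (f ≠ 0 ∧ TermDvd (o.lt f) v)

/-- One step of the total reduction of `p ≠ 0` modulo `fs`: the leading monomial of `p` is
cancelled by a multiple of the first suitable element of `fs`; if there is none, the leading
monomial is split off. -/
def trdStep (o : TermOrder α κ) (fs : List (VecPoly α κ K)) (p : VecPoly α κ K) :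
    VecPoly α κ K :=
  match o.findDvd fs (o.lt p) with
  | some f => p - monomMult (o.lc p / o.lc f) (quot (o.lt p).1 (o.lt f).1) f
  | none => o.tail p

section Termination

theorem coeff_lt_ne_zero (o : TermOrder α κ) {p : VecPoly α κ K} (hp : p ≠ 0) :
    coeff p (o.lt p) ≠ 0 := by
  rw [lt, dif_pos (keys_nonempty hp)]
  exact mem_keys.1 (@Finset.max'_mem _ o.ordT _ _)

theorem le_lt (o : TermOrder α κ) {p : VecPoly α κ K} {v : α × κ} (hv : coeff p v ≠ 0) :
    o.ordT.le v (o.lt p) := by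
  have h : (keys p).Nonempty := ⟨v, mem_keys.2 hv⟩
  rw [lt, dif_pos h]
  exact @Finset.le_max' _ o.ordT _ _ (mem_keys.2 hv)

theorem findDvd_spec (o : TermOrder α κ) {fs : List (VecPoly α κ K)} {v : α × κ}
    {f : VecPoly α κ K} (h : o.findDvd fs v = some f) :
    f ∈ fs ∧ f ≠ 0 ∧ TermDvd (o.lt f) v := by
  refine ⟨List.mem_of_find?_eq_some h, ?_⟩
  have := List.find?_some h
  simpa using this

/-- A term of `trdStep fs p` is a term of `p` or a multiple of a term of an element of `fs` by a
divisor of the leading term of `p`; it is smaller than the leading term of `p`. -/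
theorem of_mem_trdStep [IsCancelAdd α] (o : TermOrder α κ) {fs : List (VecPoly α κ K)} {p : VecPoly α κ K}
    {w : α × κ} (hw : coeff (o.trdStep fs p) w ≠ 0) :
    (o.ordT.le w (o.lt p) ∧ w ≠ o.lt p) ∧
    (coeff p w ≠ 0 ∨ ∃ f ∈ fs, ∃ v, coeff f v ≠ 0 ∧ ∃ t s, w = (t + v.1, v.2) ∧
      t + s = (o.lt p).1) := by
  unfold trdStep at hw
  split at hw
  next f hf =>
    obtain ⟨hfs, hf0, hcomp, hadds⟩ := o.findDvd_spec hf
    have hq := quot_spec hadds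
    set t := quot (o.lt p).1 (o.lt f).1 with ht
    have hltp : o.lt p = (t + (o.lt f).1, (o.lt f).2) := Prod.ext hq.symm hcomp.symm
    rw [coeff_sub] at hw
    have hor : coeff p w ≠ 0 ∨ coeff (monomMult (o.lc p / o.lc f) t f) w ≠ 0 := by
      by_contra hcon
      push Not at hcon
      rw [hcon.1, hcon.2] at hw
      simp at hw
    refine ⟨⟨?_, ?_⟩, ?_⟩
    · rcases hor with h | h
      · exact o.le_lt h
      · obtain ⟨v, rfl, hv⟩ := exists_of_coeff_monomMult h
        rw [hltp]
        exact o.stimes_mono _ _ _ (o.le_lt hv)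
    · rintro rfl
      apply hw
      have h1 : coeff (monomMult (o.lc p / o.lc f) t f) (o.lt p) = o.lc p / o.lc f * o.lc f := by
        have := coeff_monomMult (o.lc p / o.lc f) t f (o.lt f)
        rw [← hltp] at this
        exact this
      have h2 : o.lc f ≠ 0 := o.coeff_lt_ne_zero hf0
      rw [h1, div_mul_cancel₀ _ h2]
      exact sub_self _
    · rcases hor with h | h
      · exact Or.inl h
      · obtain ⟨v, hwv, hv⟩ := exists_of_coeff_monomMult h
        exact Or.inr ⟨f, hfs, v, hv, t, _, hwv, hq⟩
  next =>
    rw [tail, coeff_sub] at hw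
    have hne : w ≠ o.lt p := by
      rintro rfl
      rw [coeff_monomial_self] at hw
      exact hw (sub_self _)
    rw [coeff_monomial_ne _ hne.symm, sub_zero] at hw
    exact ⟨⟨o.le_lt hw, hne⟩, Or.inl hw⟩

/-- Total reduction terminates. -/
theorem wellFounded_trdStep [GradedDicksonPowerprod α] (o : TermOrder α κ)
    (fs : List (VecPoly α κ K)) :
    WellFounded fun q p : VecPoly α κ K => p ≠ 0 ∧ q = o.trdStep fs p := by
  classical
  rw [wellFounded_iff_isEmpty_descending_chain]
  refine ⟨fun ⟨p, hp⟩ => ?_⟩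
  obtain ⟨d, hd⟩ := GradedDicksonPowerprod.exists_grading (α := α)
  let T : Finset (α × κ) := keys (p 0) ∪ fs.toFinset.biUnion keys
  let m : ℕ := T.sup fun v => d v.1
  let C : Finset κ := T.image Prod.snd
  have hT : ∀ v ∈ T, d v.1 ≤ m ∧ v.2 ∈ C := fun v hv =>
    ⟨Finset.le_sup (f := fun v : α × κ => d v.1) hv, Finset.mem_image_of_mem _ hv⟩
  have hinv : ∀ n v, coeff (p n) v ≠ 0 → d v.1 ≤ m ∧ v.2 ∈ C := by
    intro n
    induction n with
    | zero => exact fun v hv => hT v (Finset.mem_union_left _ (mem_keys.2 hv))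
    | succ n ih =>
      intro w hw
      rw [(hp n).2] at hw
      obtain ⟨-, h | ⟨f, hf, v, hv, t, s, rfl, hts⟩⟩ := o.of_mem_trdStep hw
      · exact ih w h
      · have hv' := hT v (Finset.mem_union_right _
          (Finset.mem_biUnion.2 ⟨f, List.mem_toFinset.2 hf, mem_keys.2 hv⟩))
        have hl := (ih _ (o.coeff_lt_ne_zero (hp n).1)).1
        rw [← hts, hd.map_add] at hl
        refine ⟨?_, hv'.2⟩
        rw [hd.map_add]
        exact max_le ((le_max_left _ _).trans hl) hv'.1
  let ls : ℕ → α × κ := fun n => o.lt (p n)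
  have hls : ∀ n, d (ls n).1 ≤ m ∧ (ls n).2 ∈ C := fun n =>
    hinv n _ (o.coeff_lt_ne_zero (hp n).1)
  let _ := o.ordT
  have hanti : StrictAnti ls := by
    refine strictAnti_nat_of_succ_lt fun n => ?_
    have h := o.coeff_lt_ne_zero (hp (n + 1)).1
    have h' : coeff (o.trdStep fs (p n)) (o.lt (p (n + 1))) ≠ 0 := by
      rw [← (hp n).2]
      exact h
    obtain ⟨⟨h1, h2⟩, -⟩ := o.of_mem_trdStep h'
    exact lt_of_le_of_ne h1 h2
  have hpre : IsPreorder {t : α // t ∈ {t | d t ≤ m}} (Subrel Adds (· ∈ {t | d t ≤ m})) :=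
    { refl := fun a => ⟨0, (add_zero _).symm⟩
      trans := by
        rintro a b c ⟨u, hu⟩ ⟨v, hv⟩
        exact ⟨u + v, by rw [hv, hu, add_assoc]⟩ }
  have hwqo := (show WellQuasiOrdered (Subrel Adds (· ∈ {t | d t ≤ m})) from hd.dickson m).prod
    (Finite.wellQuasiOrdered (α := C) Eq)
  obtain ⟨i, j, hij, ⟨u, hu⟩, h2⟩ := hwqo fun n => (⟨(ls n).1, (hls n).1⟩, ⟨(ls n).2, (hls n).2⟩)
  have h2' : (ls i).2 = (ls j).2 := congrArg Subtype.val h2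
  have hle : ls i ≤ ls j := by
    refine o.ord_termI _ _ ?_ h2'.le
    have h3 := o.add_mono 0 u (ls i).1 (o.zero_min u)
    rw [zero_add, add_comm u] at h3
    have hu' : (ls j).1 = (ls i).1 + u := hu
    rw [hu']
    exact h3
  exact absurd (hanti hij) (not_lt.2 hle)

end Termination

section Algorithm

open scoped Classical in
/-- Total reduction of `p` modulo `fs`: the terms of `p` are processed in descending order, and
each of them is reduced by the first suitable element of `fs` or else moved to the result. -/
def trd [GradedDicksonPowerprod α] (o : TermOrder α κ) (fs : List (VecPoly α κ K)) (p : VecPoly α κ K) :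
    VecPoly α κ K :=
  if _h : p = 0 then 0
  else (if (o.findDvd fs (o.lt p)).isSome then 0 else monomial (o.lc p) (o.lt p)) +
    trd o fs (o.trdStep fs p)
termination_by (o.wellFounded_trdStep fs).wrap p
decreasing_by exact ⟨_h, rfl⟩

open scoped Classical in
/-- Moves the elements of `xs` one by one to `ys`, dropping those whose leading term is divisible
by the leading term of another element that is still present in `xs` or `ys`. -/
def filterMinAux (o : TermOrder α κ) :
    List (VecPoly α κ K) → List (VecPoly α κ K) → List (VecPoly α κ K)
  | [], ys => ys
  | x :: xs, ys =>
    if ∃ y ∈ xs ++ ys, TermDvd (o.lt y) (o.lt x) then filterMinAux o xs ys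
    else filterMinAux o xs (x :: ys)

open scoped Classical in
/-- Removes `0` and all elements whose leading term is divisible by the leading term of another
remaining element. -/
def compMinBasis (o : TermOrder α κ) (xs : List (VecPoly α κ K)) : List (VecPoly α κ K) :=
  o.filterMinAux (xs.filter fun x => decide (x ≠ 0)) []

/-- Replaces the elements of `xs` one by one by their total reductions modulo all other (already
replaced or still unreplaced) elements. -/
def compRedBasisAux [GradedDicksonPowerprod α] (o : TermOrder α κ) :
    List (VecPoly α κ K) → List (VecPoly α κ K) → List (VecPoly α κ K)
  | [], ys => ys
  | x :: xs, ys => compRedBasisAux o xs (o.trd (xs ++ ys) x :: ys)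

/-- The function `comp_red_monic_basis`: remove superfluous elements, totally reduce every
remaining element modulo the others, and make the results monic. -/
def compRedMonicBasis [GradedDicksonPowerprod α] (o : TermOrder α κ)
    (xs : List (VecPoly α κ K)) : List (VecPoly α κ K) :=
  (o.compRedBasisAux (o.compMinBasis xs) []).map o.monic

end Algorithm

end TermOrder

/-- The submodule generated by a set of vector-polynomials. -/
abbrev pmdl {α κ K : Type*} [AddCommMonoid α] [Field K] (B : Set (VecPoly α κ K)) :
    Submodule (AddMonoidAlgebra K α) (VecPoly α κ K) :=
  Submodule.span (AddMonoidAlgebra K α) B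

end ModuleGB

end

/-!
If `G` is a Gröbner basis, then `→_G` is confluent, so every element of `pmdl G` reduces to `0`; the
leading term of a non-zero element is then cancelled at some point, hence it is divisible by the
leading term of an element of `G`. Conversely, a finite subset of a submodule `N` whose leading
terms divide those of all non-zero elements of `N` generates `N` and is a Gröbner basis, because an
element of `N` in normal form must be `0`. This criterion only depends on leading terms, which none
of the three steps of `compRedMonicBasis` changes, except that the first step drops superfluous
ones.

If `A` and `B` are reduced Gröbner bases of the same submodule, then they have the same leading
terms. For `a ∈ A` and `b ∈ B` with the same leading term `v`, the difference `a - b` has a leading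
term below `v`, which appears in `a` or in `b`, but is divisible by leading terms of `A` and of
`B`; this contradicts auto-reducedness.

As `α` need not be finitely generated, Dickson's lemma only applies below a fixed degree `m` of the
grading `d`. Every power-product splits as `r + s`, where `d s ≤ m` and `r` has no divisor of
degree `≤ m` except `0`. If all generators of `N` have degree at most `m`, then the part of `p ∈ N`
that is supported on the multiples of `r` by power-products of degree `≤ m` is `r` times an element
of `N` of degree at most `m`. Hence every leading term of `N` is divisible by one of degree at
most `m`, and finitely many of these suffice.
-/

namespace ModuleGB

section General

theorem exists_finite_cover_of_partiallyWellOrderedOn {β : Type*} {r : β → β → Prop} {s : Set β}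
    (hs : s.PartiallyWellOrderedOn r) : ∃ t ⊆ s, t.Finite ∧ ∀ x ∈ s, ∃ y ∈ t, r y x := by
  by_contra! h
  obtain ⟨f, hfs, hf⟩ := exists_seq_of_forall_finset_exists (· ∈ s) (fun y x => ¬ r y x)
    fun t ht => h t ht t.finite_toSet
  obtain ⟨i, j, hij, hr⟩ := hs.exists_lt hfs
  exact hf i j hij hr

theorem span_induction_of_single_smul {R α M : Type*} [Semiring R] [AddMonoid α]
    [AddCommMonoid M] [Module (AddMonoidAlgebra R α) M] {F : Set M} {P : M → Prop} (zero : P 0)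
    (add : ∀ x y, P x → P y → P (x + y))
    (single_smul : ∀ (c : R) (t : α), ∀ f ∈ F, P (AddMonoidAlgebra.single t c • f)) {x : M}
    (hx : x ∈ Submodule.span (AddMonoidAlgebra R α) F) : P x := by
  induction hx using Submodule.closure_induction with
  | zero => exact zero
  | add x y _ _ hx hy => exact add x y hx hy
  | smul_mem a f hf =>
    induction a using AddMonoidAlgebra.induction_linear with
    | zero => rwa [zero_smul]
    | add a b ha hb => rw [add_smul]; exact add _ _ ha hb
    | single t c => exact single_smul c t f hf

theorem span_insert_eq_of_sub_mem {R M : Type*} [Ring R] [AddCommGroup M] [Module R M]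
    {s : Set M} {x y : M} (h : x - y ∈ Submodule.span R s) :
    Submodule.span R (insert y s) = Submodule.span R (insert x s) := by
  have hle : ∀ {x y : M}, x - y ∈ Submodule.span R s →
      Submodule.span R (insert y s) ≤ Submodule.span R (insert x s) := by
    intro x y h
    have hs := Submodule.span_mono (R := R) (Set.subset_insert x s)
    refine Submodule.span_le.2 (Set.insert_subset ?_ (Submodule.span_le.1 hs))
    simpa using Submodule.sub_mem _ (Submodule.subset_span (Set.mem_insert x s)) (hs h)
  exact (hle h).antisymm (hle (by simpa using Submodule.neg_mem _ h))

theorem exists_list_setOf_mem_eq {β : Type*} {s : Set β} (hs : s.Finite) :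
    ∃ l : List β, {x | x ∈ l} = s :=
  ⟨hs.toFinset.toList, by simp⟩

theorem setOf_mem_cons {β : Type*} (x : β) (xs : List β) :
    {z | z ∈ x :: xs} = insert x {z | z ∈ xs} :=
  Set.ext fun _ => List.mem_cons

theorem setOf_mem_append_cons {β : Type*} (xs ys : List β) (x : β) :
    {z | z ∈ xs ++ x :: ys} = insert x {z | z ∈ xs ++ ys} :=
  Set.ext fun _ => List.perm_middle.mem_iff.trans List.mem_cons

end General

section Coefficients

variable {α κ K : Type*} [Field K]

theorem coeff_zero (v : α × κ) : coeff (0 : VecPoly α κ K) v = 0 := by simp [coeff]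

theorem coeff_add (p q : VecPoly α κ K) (v : α × κ) :
    coeff (p + q) v = coeff p v + coeff q v := by
  simp [coeff]

theorem ne_zero_of_coeff_ne_zero {p : VecPoly α κ K} {v : α × κ} (h : coeff p v ≠ 0) : p ≠ 0 := by
  rintro rfl
  exact h (coeff_zero v)

theorem coeff_ne_zero_or_of_coeff_add_ne_zero {p q : VecPoly α κ K} {v : α × κ}
    (h : coeff (p + q) v ≠ 0) : coeff p v ≠ 0 ∨ coeff q v ≠ 0 := by
  contrapose! h
  rw [coeff_add, h.1, h.2, add_zero]

end Coefficients

section MonomMult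

variable {α κ K : Type*} [AddCommMonoid α] [Field K]

theorem coeff_ne_zero_or_of_coeff_sub_ne_zero {p q : VecPoly α κ K} {v : α × κ}
    (h : coeff (p - q) v ≠ 0) : coeff p v ≠ 0 ∨ coeff q v ≠ 0 := by
  contrapose! h
  rw [coeff_sub, h.1, h.2, sub_zero]

theorem coeff_monomMult_zero [IsCancelAdd α] (c : K) (p : VecPoly α κ K) (v : α × κ) :
    coeff (monomMult c 0 p) v = c * coeff p v := by
  simpa using coeff_monomMult c 0 p v

theorem monomMult_zero_left (t : α) (p : VecPoly α κ K) : monomMult (0 : K) t p = 0 := by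
  simp [monomMult]

theorem monomMult_zero_right (c : K) (t : α) : monomMult c t (0 : VecPoly α κ K) = 0 :=
  smul_zero _

theorem monomMult_one_zero (p : VecPoly α κ K) : monomMult (1 : K) 0 p = p :=
  one_smul (AddMonoidAlgebra K α) p

theorem sub_monomMult (c c' : K) (t : α) (p : VecPoly α κ K) :
    monomMult (c - c') t p = monomMult c t p - monomMult c' t p := by
  rw [monomMult, monomMult, monomMult, AddMonoidAlgebra.single_sub, sub_smul]

theorem monomMult_monomMult (c c' : K) (s t : α) (p : VecPoly α κ K) :
    monomMult c s (monomMult c' t p) = monomMult (c * c') (s + t) p := by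
  rw [monomMult, monomMult, monomMult, smul_smul, AddMonoidAlgebra.single_mul_single]

theorem monomMult_mem {N : Submodule (AddMonoidAlgebra K α) (VecPoly α κ K)} {p : VecPoly α κ K}
    (hp : p ∈ N) (c : K) (t : α) : monomMult c t p ∈ N :=
  N.smul_mem _ hp

end MonomMult

section Divisibility

instance isPreorder_adds {α : Type*} [AddMonoid α] : IsPreorder α Adds where
  refl s := ⟨0, (add_zero s).symm⟩
  trans := by
    rintro r _ _ ⟨s, rfl⟩ ⟨t, rfl⟩
    exact ⟨s + t, add_assoc r s t⟩

variable {α κ : Type*} [AddCommMonoid α]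

theorem TermDvd.refl (v : α × κ) : TermDvd v v := ⟨rfl, refl_of Adds v.1⟩

theorem TermDvd.trans {u v w : α × κ} (h : TermDvd u v) (h' : TermDvd v w) :
    TermDvd u w :=
  ⟨h.1.trans h'.1, trans_of Adds h.2 h'.2⟩

theorem termDvd_iff {v w : α × κ} : TermDvd v w ↔ ∃ t, w = (t + v.1, v.2) := by
  constructor
  · rintro ⟨h, u, hu⟩
    exact ⟨u, Prod.ext (hu.trans (add_comm _ _)) h.symm⟩
  · rintro ⟨t, rfl⟩
    exact ⟨rfl, t, add_comm _ _⟩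

/-- The terms in `V` are covered by the terms in `W`: each of them is divisible by one of the
latter, i.e. it lies in the monomial submodule generated by `W`. -/
def DvdCovers (W V : Set (α × κ)) : Prop := ∀ v ∈ V, ∃ w ∈ W, TermDvd w v

theorem DvdCovers.trans {U V W : Set (α × κ)} (h : DvdCovers U V)
    (h' : DvdCovers V W) : DvdCovers U W := by
  intro w hw
  obtain ⟨v, hv, hvw⟩ := h' w hw
  obtain ⟨u, hu, huv⟩ := h v hv
  exact ⟨u, hu, huv.trans hvw⟩

end Divisibility

namespace TermOrder

section Order

theorem le_of_termDvd {α κ : Type*} [AddCommMonoid α] [Preorder κ] (o : TermOrder α κ)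
    {v w : α × κ} (h : TermDvd v w) : o.ordT.le v w := by
  obtain ⟨hcomp, u, hu⟩ := h
  refine o.ord_termI v w ?_ hcomp.le
  simpa [hu, add_comm] using o.add_mono 0 u v.1 (o.zero_min u)

theorem termDvd_antisymm {α κ : Type*} [AddCommMonoid α] [Preorder κ] (o : TermOrder α κ)
    {v w : α × κ} (h : TermDvd v w) (h' : TermDvd w v) : v = w :=
  o.ordT.le_antisymm v w (o.le_of_termDvd h) (o.le_of_termDvd h')

variable {α κ K : Type*} [AddCommMonoid α] [LinearOrder κ] [Nonempty κ] [Field K]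

theorem lt_eq (o : TermOrder α κ) {p : VecPoly α κ K} {v : α × κ} (hv : coeff p v ≠ 0)
    (h : ∀ w, coeff p w ≠ 0 → o.ordT.le w v) : o.lt p = v :=
  o.ordT.le_antisymm _ _ (h _ (o.coeff_lt_ne_zero (ne_zero_of_coeff_ne_zero hv))) (o.le_lt hv)

theorem lt_sub_lt (o : TermOrder α κ) {a b : VecPoly α κ K} (hab : a - b ≠ 0)
    (hlt : o.lt a = o.lt b) (hlc : o.lc a = o.lc b) :
    o.ordT.lt (o.lt (a - b)) (o.lt a) := by
  let _ := o.ordT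
  have hcoeff := o.coeff_lt_ne_zero hab
  refine lt_of_le_of_ne ?_ fun heq => ?_
  · rcases coeff_ne_zero_or_of_coeff_sub_ne_zero hcoeff with h | h
    · exact o.le_lt h
    · exact hlt ▸ o.le_lt h
  · apply hcoeff
    rw [heq, coeff_sub, sub_eq_zero]
    simpa only [lc, ← hlt] using hlc

theorem le_of_coeff_monomMult_ne_zero [IsCancelAdd α] (o : TermOrder α κ) {c : K} {t : α}
    {f : VecPoly α κ K} {w : α × κ} (h : coeff (monomMult c t f) w ≠ 0) :
    o.ordT.le w (t + (o.lt f).1, (o.lt f).2) := by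
  obtain ⟨v, rfl, hv⟩ := exists_of_coeff_monomMult h
  exact o.stimes_mono _ _ _ (o.le_lt hv)

end Order

section LeadTerms

variable {α κ K : Type*} [AddCommMonoid α] [LinearOrder κ] [Nonempty κ] [Field K]

/-- The set of leading terms of the non-zero elements of `F`. -/
def leadTerms (o : TermOrder α κ) (F : Set (VecPoly α κ K)) : Set (α × κ) := o.lt '' (F \ {0})

theorem lt_mem_leadTerms (o : TermOrder α κ) {F : Set (VecPoly α κ K)} {p : VecPoly α κ K}
    (hp : p ∈ F) (hp0 : p ≠ 0) : o.lt p ∈ o.leadTerms F :=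
  Set.mem_image_of_mem _ ⟨hp, hp0⟩

theorem leadTerms_mono (o : TermOrder α κ) {F G : Set (VecPoly α κ K)} (h : F ⊆ G) :
    o.leadTerms F ⊆ o.leadTerms G :=
  Set.image_mono (Set.sdiff_subset_sdiff_left h)

theorem leadTerms_insert (o : TermOrder α κ) (F : Set (VecPoly α κ K)) {p : VecPoly α κ K}
    (hp : p ≠ 0) : o.leadTerms (insert p F) = insert (o.lt p) (o.leadTerms F) := by
  rw [leadTerms, Set.insert_sdiff_of_notMem _ (by simpa using hp), Set.image_insert_eq, leadTerms]

end LeadTerms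

section Reduction

variable {α κ K : Type*} [AddCommMonoid α] [LinearOrder κ] [Nonempty κ] [Field K]
  {o : TermOrder α κ} {F G : Set (VecPoly α κ K)} {p q : VecPoly α κ K}

open Relation (ReflTransGen Join)

theorem not_red_zero : ¬ o.Red F 0 q := by
  rintro ⟨f, -, t, -, h, -⟩
  exact h (coeff_zero _)

theorem isRed_iff : o.IsRed F p ↔ ∃ w ∈ o.leadTerms F, ∃ v, coeff p v ≠ 0 ∧ TermDvd w v := by
  constructor
  · rintro ⟨-, f, hf, t, hf0, hv, -⟩
    exact ⟨o.lt f, o.lt_mem_leadTerms hf hf0, _, hv, termDvd_iff.2 ⟨t, rfl⟩⟩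
  · rintro ⟨-, ⟨f, ⟨hf, hf0⟩, rfl⟩, v, hv, hdvd⟩
    obtain ⟨t, rfl⟩ := termDvd_iff.1 hdvd
    exact ⟨_, f, hf, t, hf0, hv, rfl⟩

theorem isRed_of_dvdCovers {N : Set (VecPoly α κ K)}
    (h : DvdCovers (o.leadTerms G) (o.leadTerms N)) (hq : q ∈ N) (hq0 : q ≠ 0)
    (hp : coeff p (o.lt q) ≠ 0) : o.IsRed G p := by
  obtain ⟨w, hw, hdvd⟩ := h _ (o.lt_mem_leadTerms hq hq0)
  exact isRed_iff.2 ⟨w, hw, o.lt q, hp, hdvd⟩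

theorem IsRed.left_or_right_of_add (h : o.IsRed F (p + q)) : o.IsRed F p ∨ o.IsRed F q := by
  obtain ⟨w, hw, v, hv, hdvd⟩ := isRed_iff.1 h
  exact (coeff_ne_zero_or_of_coeff_add_ne_zero hv).imp
    (fun hp => isRed_iff.2 ⟨w, hw, v, hp, hdvd⟩) fun hq => isRed_iff.2 ⟨w, hw, v, hq, hdvd⟩

theorem sub_mem_pmdl_of_reflTransGen_red (h : ReflTransGen (o.Red F) p q) : p - q ∈ pmdl F := by
  induction h with
  | refl => simp
  | tail _ h ih =>
    obtain ⟨f, hf, t, -, -, rfl⟩ := h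
    rw [← sub_add]
    exact Submodule.add_mem _ ih (monomMult_mem (Submodule.subset_span hf) _ _)

theorem reflTransGen_red_sub_monomMult {f : VecPoly α κ K} (hf : f ∈ F) (hf0 : f ≠ 0)
    (p : VecPoly α κ K) (t : α) :
    ReflTransGen (o.Red F) p
      (p - monomMult (coeff p (t + (o.lt f).1, (o.lt f).2) / o.lc f) t f) := by
  by_cases h : coeff p (t + (o.lt f).1, (o.lt f).2) = 0
  · rw [h, zero_div, monomMult_zero_left, sub_zero]
  · exact .single ⟨f, hf, t, hf0, h, rfl⟩

variable [IsCancelAdd α]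

theorem coeff_lt_eq_of_red (hpq : o.Red F p q) (h : ∀ w ∈ o.leadTerms F, ¬ TermDvd w (o.lt p)) :
    coeff q (o.lt p) = coeff p (o.lt p) := by
  obtain ⟨f, hf, t, hf0, hv, rfl⟩ := hpq
  rw [coeff_sub, sub_eq_self]
  by_contra hne
  have heq : o.lt p = (t + (o.lt f).1, (o.lt f).2) :=
    o.ordT.le_antisymm _ _ (o.le_of_coeff_monomMult_ne_zero hne) (o.le_lt hv)
  exact h _ (o.lt_mem_leadTerms hf hf0) (termDvd_iff.2 ⟨t, heq⟩)

theorem le_lt_of_red (hpq : o.Red F p q) {w : α × κ} (hw : coeff q w ≠ 0) :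
    o.ordT.le w (o.lt p) := by
  obtain ⟨f, -, t, -, hv, rfl⟩ := hpq
  rcases coeff_ne_zero_or_of_coeff_sub_ne_zero hw with h | h
  · exact o.le_lt h
  · exact o.ordT.le_trans _ _ _ (o.le_of_coeff_monomMult_ne_zero h) (o.le_lt hv)

theorem ne_zero_and_lt_eq_of_reflTransGen_red (hpq : ReflTransGen (o.Red F) p q) (hp : p ≠ 0)
    (h : ∀ w ∈ o.leadTerms F, ¬ TermDvd w (o.lt p)) : q ≠ 0 ∧ o.lt q = o.lt p := by
  induction hpq with
  | refl => exact ⟨hp, rfl⟩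
  | @tail r s _ hrs ih =>
    obtain ⟨hr0, hr⟩ := ih
    have hcoeff : coeff s (o.lt r) ≠ 0 := by
      rw [coeff_lt_eq_of_red hrs (hr.symm ▸ h)]
      exact o.coeff_lt_ne_zero hr0
    exact ⟨ne_zero_of_coeff_ne_zero hcoeff,
      (o.lt_eq hcoeff fun w hw => le_lt_of_red hrs hw).trans hr⟩

/-- Cancelling the term `t * lt f` leads `q + c t f` and `q` to the same result. -/
theorem join_red_add_monomMult {f : VecPoly α κ K} (hf : f ∈ F) (q : VecPoly α κ K) (c : K)
    (t : α) : Join (ReflTransGen (o.Red F)) (q + monomMult c t f) q := by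
  by_cases hf0 : f = 0
  · rw [hf0, monomMult_zero_right, add_zero]
    exact ⟨q, .refl, .refl⟩
  have hlc : o.lc f ≠ 0 := o.coeff_lt_ne_zero hf0
  refine ⟨_, ?_, reflTransGen_red_sub_monomMult hf hf0 q t⟩
  convert reflTransGen_red_sub_monomMult hf hf0 (q + monomMult c t f) t using 1
  rw [coeff_add, coeff_monomMult, ← lc, add_div, mul_div_cancel_right₀ c hlc, add_sub_assoc,
    ← sub_monomMult, sub_add_cancel_right, ← zero_sub, sub_monomMult, monomMult_zero_left]
  abel

theorem IsGroebnerBasis.reflTransGen_red_zero (hG : o.IsGroebnerBasis G) (hp : p ∈ pmdl G) :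
    ReflTransGen (o.Red G) p 0 := by
  have : IsTrans _ (Join (ReflTransGen (o.Red G))) := Relation.isTrans_join hG
  have hjoin : ∀ q, Join (ReflTransGen (o.Red G)) (q + p) q := by
    refine span_induction_of_single_smul
      (P := fun p => ∀ q, Join (ReflTransGen (o.Red G)) (q + p) q) (fun q => ?_)
      (fun x y hx hy q => ?_) (fun c t f hf q => join_red_add_monomMult hf q c t) hp
    · rw [add_zero]
      exact ⟨q, .refl, .refl⟩
    · rw [← add_assoc]
      exact _root_.trans (hy (q + x)) (hx q)
  obtain ⟨r, hr, h0⟩ := hjoin 0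
  rw [zero_add] at hr
  rcases h0.cases_head with rfl | ⟨_, hred, -⟩
  · exact hr
  · exact absurd hred not_red_zero

theorem IsGroebnerBasis.dvdCovers_leadTerms_pmdl (hG : o.IsGroebnerBasis G) :
    DvdCovers (o.leadTerms G) (o.leadTerms (pmdl G : Set (VecPoly α κ K))) := by
  rintro _ ⟨p, ⟨hp, hp0⟩, rfl⟩
  by_contra! h
  exact (ne_zero_and_lt_eq_of_reflTransGen_red (hG.reflTransGen_red_zero hp) hp0 h).1 rfl

end Reduction

section Uniqueness

variable {α κ K : Type*} [AddCommMonoid α] [LinearOrder κ] [Nonempty κ] [Field K]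
  {o : TermOrder α κ} {A B : Set (VecPoly α κ K)} {a b : VecPoly α κ K}

theorem IsReducedGB.eq_of_termDvd (hA : o.IsReducedGB A) (ha : a ∈ A) (hb : b ∈ A) {v : α × κ}
    (hv : coeff b v ≠ 0) (h : TermDvd (o.lt a) v) : a = b := by
  by_contra hne
  have ha0 : a ≠ 0 := ne_of_mem_of_not_mem ha hA.zero_notMem
  exact hA.isAutoReduced b hb (isRed_iff.2 ⟨_, o.lt_mem_leadTerms ⟨ha, hne⟩ ha0, v, hv, h⟩)

variable [IsCancelAdd α]

theorem IsReducedGB.coeff_lt_eq_zero (hA : o.IsReducedGB A) (ha : a ∈ A) {p : VecPoly α κ K}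
    (hp : p ∈ pmdl A) (hp0 : p ≠ 0) (hlt : o.ordT.lt (o.lt p) (o.lt a)) :
    coeff a (o.lt p) = 0 := by
  let _ := o.ordT
  by_contra h
  obtain ⟨-, ⟨b, ⟨hb, -⟩, rfl⟩, hdvd⟩ :=
    hA.isGroebnerBasis.dvdCovers_leadTerms_pmdl _ (o.lt_mem_leadTerms hp hp0)
  obtain rfl := hA.eq_of_termDvd hb ha h hdvd
  exact (o.le_of_termDvd hdvd).not_gt hlt

theorem IsReducedGB.exists_lt_eq (hA : o.IsReducedGB A) (hB : o.IsReducedGB B)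
    (h : pmdl A = pmdl B) (ha : a ∈ A) : ∃ b ∈ B, o.lt b = o.lt a := by
  have ha0 : a ≠ 0 := ne_of_mem_of_not_mem ha hA.zero_notMem
  have ha_pmdl : a ∈ pmdl B := h ▸ Submodule.subset_span ha
  obtain ⟨-, ⟨b, ⟨hb, hb0⟩, rfl⟩, hba⟩ :=
    hB.isGroebnerBasis.dvdCovers_leadTerms_pmdl _ (o.lt_mem_leadTerms ha_pmdl ha0)
  have hb_pmdl : b ∈ pmdl A := h ▸ Submodule.subset_span hb
  obtain ⟨-, ⟨a', ⟨ha', -⟩, rfl⟩, hab⟩ :=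
    hA.isGroebnerBasis.dvdCovers_leadTerms_pmdl _ (o.lt_mem_leadTerms hb_pmdl hb0)
  obtain rfl := hA.eq_of_termDvd ha' ha (o.coeff_lt_ne_zero ha0) (hab.trans hba)
  exact ⟨b, hb, o.termDvd_antisymm hba hab⟩

theorem IsReducedGB.eq_of_lt_eq (hA : o.IsReducedGB A) (hB : o.IsReducedGB B)
    (h : pmdl A = pmdl B) (ha : a ∈ A) (hb : b ∈ B) (hlt : o.lt a = o.lt b) : a = b := by
  by_contra hne
  have hsub0 : a - b ≠ 0 := sub_ne_zero.2 hne
  have hsub : a - b ∈ pmdl A :=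
    Submodule.sub_mem _ (Submodule.subset_span ha) (h ▸ Submodule.subset_span hb)
  have hlt_sub := o.lt_sub_lt hsub0 hlt ((hA.monic a ha).trans (hB.monic b hb).symm)
  apply o.coeff_lt_ne_zero hsub0
  rw [coeff_sub, hA.coeff_lt_eq_zero ha hsub hsub0 hlt_sub,
    hB.coeff_lt_eq_zero hb (h ▸ hsub) hsub0 (hlt ▸ hlt_sub), sub_zero]

theorem IsReducedGB.subset_of_pmdl_eq (hA : o.IsReducedGB A) (hB : o.IsReducedGB B)
    (h : pmdl A = pmdl B) : A ⊆ B := by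
  intro a ha
  obtain ⟨b, hb, hlt⟩ := hA.exists_lt_eq hB h ha
  rwa [hA.eq_of_lt_eq hB h ha hb hlt.symm]

theorem IsReducedGB.eq_of_pmdl_eq (hA : o.IsReducedGB A) (hB : o.IsReducedGB B)
    (h : pmdl A = pmdl B) : A = B :=
  (hA.subset_of_pmdl_eq hB h).antisymm (hB.subset_of_pmdl_eq hA h.symm)

end Uniqueness

section TotalReduction

variable {α κ K : Type*} [AddCommMonoid α] [LinearOrder κ] [Nonempty κ] [Field K]
  (o : TermOrder α κ) {fs : List (VecPoly α κ K)} {p f : VecPoly α κ K}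

theorem findDvd_eq_none_iff {v : α × κ} :
    o.findDvd fs v = none ↔ ∀ w ∈ o.leadTerms {x | x ∈ fs}, ¬ TermDvd w v := by
  simp [findDvd, leadTerms, Set.forall_mem_image, -Set.mem_image]

theorem redSingle_add_trdStep (hp : p ≠ 0) (hf : o.findDvd fs (o.lt p) = some f)
    {r : VecPoly α κ K} (hr : coeff r (o.lt p) = 0) :
    o.RedSingle (r + p) (r + o.trdStep fs p) f (quot (o.lt p).1 (o.lt f).1) := by
  obtain ⟨-, hf0, hcomp, hadds⟩ := o.findDvd_spec hf
  have hlt : (quot (o.lt p).1 (o.lt f).1 + (o.lt f).1, (o.lt f).2) = o.lt p :=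
    Prod.ext (quot_spec hadds) hcomp
  have hcoeff : coeff (r + p) (o.lt p) = o.lc p := by rw [coeff_add, hr, zero_add, lc]
  refine ⟨hf0, ?_, ?_⟩
  · rw [hlt, hcoeff]
    exact o.coeff_lt_ne_zero hp
  · rw [hlt, hcoeff, trdStep, hf, add_sub_assoc]

theorem monomial_add_trdStep (hf : o.findDvd fs (o.lt p) = none) :
    monomial (o.lc p) (o.lt p) + o.trdStep fs p = p := by
  rw [trdStep, hf, tail, add_sub_cancel]

variable [GradedDicksonPowerprod α]

theorem trd_zero (fs : List (VecPoly α κ K)) : o.trd fs 0 = 0 := by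
  rw [trd, dif_pos rfl]

theorem trd_of_findDvd_eq_some (hp : p ≠ 0) (hf : o.findDvd fs (o.lt p) = some f) :
    o.trd fs p = o.trd fs (o.trdStep fs p) := by
  rw [trd, dif_neg hp, hf, Option.isSome_some, if_pos rfl, zero_add]

theorem trd_of_findDvd_eq_none (hp : p ≠ 0) (hf : o.findDvd fs (o.lt p) = none) :
    o.trd fs p = monomial (o.lc p) (o.lt p) + o.trd fs (o.trdStep fs p) := by
  rw [trd, dif_neg hp, hf, Option.isSome_none, if_neg Bool.false_ne_true]

theorem trdStep_induction (fs : List (VecPoly α κ K)) {P : VecPoly α κ K → Prop} (zero : P 0)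
    (step : ∀ p, p ≠ 0 → P (o.trdStep fs p) → P p) (p : VecPoly α κ K) : P p := by
  induction p using (o.wellFounded_trdStep fs).induction with
  | _ p ih =>
    by_cases hp : p = 0
    · exact hp ▸ zero
    · exact step p hp (ih _ ⟨hp, rfl⟩)

/-- The summand `r` collects the monomials that have already been moved to the result; all its
terms exceed those of `p`. -/
theorem reflTransGen_red_add_trd (fs : List (VecPoly α κ K)) (p r : VecPoly α κ K)
    (hr : ∀ w, coeff p w ≠ 0 → ∀ v, o.ordT.le v w → coeff r v = 0) :
    Relation.ReflTransGen (o.Red {x | x ∈ fs}) (r + p) (r + o.trd fs p) := by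
  induction p using o.trdStep_induction fs generalizing r with
  | zero => rw [trd_zero]
  | step p hp ih =>
    have hr_le := hr _ (o.coeff_lt_ne_zero hp)
    cases hf : o.findDvd fs (o.lt p) with
    | some f =>
      rw [o.trd_of_findDvd_eq_some hp hf]
      have hstep := o.redSingle_add_trdStep hp hf (hr_le _ (o.ordT.le_refl _))
      refine .head ⟨f, (o.findDvd_spec hf).1, _, hstep⟩ (ih r fun w hw v hv => ?_)
      exact hr_le v (o.ordT.le_trans _ _ _ hv (o.of_mem_trdStep hw).1.1)
    | none =>
      have hih := ih (r + monomial (o.lc p) (o.lt p)) fun w hw v hv => ?_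
      · rwa [add_assoc, monomial_add_trdStep o hf, add_assoc,
          ← o.trd_of_findDvd_eq_none hp hf] at hih
      · obtain ⟨⟨hle, hne⟩, -⟩ := o.of_mem_trdStep hw
        rw [coeff_add, hr_le v (o.ordT.le_trans _ _ _ hv hle), zero_add]
        refine coeff_monomial_ne _ ?_
        rintro rfl
        exact hne (o.ordT.le_antisymm _ _ hle hv)

theorem reflTransGen_red_trd (fs : List (VecPoly α κ K)) (p : VecPoly α κ K) :
    Relation.ReflTransGen (o.Red {x | x ∈ fs}) p (o.trd fs p) := by
  simpa using o.reflTransGen_red_add_trd fs p 0 fun _ _ v _ => coeff_zero v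

theorem sub_trd_mem_pmdl (fs : List (VecPoly α κ K)) (p : VecPoly α κ K) :
    p - o.trd fs p ∈ pmdl {x | x ∈ fs} :=
  sub_mem_pmdl_of_reflTransGen_red (o.reflTransGen_red_trd fs p)

theorem not_isRed_trd (fs : List (VecPoly α κ K)) (p : VecPoly α κ K) :
    ¬ o.IsRed {x | x ∈ fs} (o.trd fs p) := by
  induction p using o.trdStep_induction fs with
  | zero =>
    rintro ⟨q, hq⟩
    rw [trd_zero] at hq
    exact not_red_zero hq
  | step p hp ih =>
    cases hf : o.findDvd fs (o.lt p) with
    | some f => rwa [o.trd_of_findDvd_eq_some hp hf]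
    | none =>
      rw [o.trd_of_findDvd_eq_none hp hf]
      intro hred
      refine hred.left_or_right_of_add.elim (fun hmon => ?_) ih
      obtain ⟨w, hw, v, hv, hdvd⟩ := isRed_iff.1 hmon
      obtain rfl : o.lt p = v := by
        by_contra hne
        exact hv (coeff_monomial_ne _ hne)
      exact o.findDvd_eq_none_iff.1 hf w hw hdvd

theorem exists_reflTransGen_red_not_isRed {G : Set (VecPoly α κ K)} (hG : G.Finite)
    (p : VecPoly α κ K) : ∃ q, Relation.ReflTransGen (o.Red G) p q ∧ ¬ o.IsRed G q := by
  obtain ⟨fs, rfl⟩ := exists_list_setOf_mem_eq hG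
  exact ⟨o.trd fs p, o.reflTransGen_red_trd fs p, o.not_isRed_trd fs p⟩

end TotalReduction

section Criterion

variable {α κ K : Type*} [AddCommMonoid α] [LinearOrder κ] [Nonempty κ] [Field K]
  {o : TermOrder α κ} {G : Set (VecPoly α κ K)}

theorem eq_zero_of_not_isRed_of_dvdCovers {N : Set (VecPoly α κ K)} {p : VecPoly α κ K}
    (h : DvdCovers (o.leadTerms G) (o.leadTerms N)) (hp : p ∈ N) (hred : ¬ o.IsRed G p) :
    p = 0 := by
  by_contra hp0
  exact hred (isRed_of_dvdCovers h hp hp0 (o.coeff_lt_ne_zero hp0))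

variable [GradedDicksonPowerprod α] {N : Submodule (AddMonoidAlgebra K α) (VecPoly α κ K)}

theorem pmdl_eq_of_dvdCovers (hfin : G.Finite) (hGN : G ⊆ N)
    (h : DvdCovers (o.leadTerms G) (o.leadTerms (N : Set (VecPoly α κ K)))) : pmdl G = N := by
  have hle : pmdl G ≤ N := Submodule.span_le.2 hGN
  refine hle.antisymm fun p hp => ?_
  obtain ⟨q, hpq, hq⟩ := o.exists_reflTransGen_red_not_isRed hfin p
  have hsub := sub_mem_pmdl_of_reflTransGen_red hpq
  have hqN : q ∈ N := by simpa using N.sub_mem hp (hle hsub)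
  rwa [eq_zero_of_not_isRed_of_dvdCovers h hqN hq, sub_zero] at hsub

theorem isGroebnerBasis_of_dvdCovers (hfin : G.Finite)
    (h : DvdCovers (o.leadTerms G) (o.leadTerms (pmdl G : Set (VecPoly α κ K)))) :
    o.IsGroebnerBasis G := by
  intro p q r hpq hpr
  obtain ⟨q', hqq', hq'⟩ := o.exists_reflTransGen_red_not_isRed hfin q
  obtain ⟨r', hrr', hr'⟩ := o.exists_reflTransGen_red_not_isRed hfin r
  obtain rfl : q' = r' := by
    by_contra hne
    have hsub0 : q' - r' ≠ 0 := sub_ne_zero.2 hne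
    have hsub : q' - r' ∈ pmdl G := by
      simpa using Submodule.sub_mem _ (sub_mem_pmdl_of_reflTransGen_red (hpr.trans hrr'))
        (sub_mem_pmdl_of_reflTransGen_red (hpq.trans hqq'))
    rcases coeff_ne_zero_or_of_coeff_sub_ne_zero (o.coeff_lt_ne_zero hsub0) with hc | hc
    · exact hq' (isRed_of_dvdCovers h hsub hsub0 hc)
    · exact hr' (isRed_of_dvdCovers h hsub hsub0 hc)
  exact ⟨q', hqq', hrr'⟩

end Criterion

section MinimalBasis

variable {α κ K : Type*} [AddCommMonoid α] [LinearOrder κ] [Nonempty κ] [Field K]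
  {o : TermOrder α κ}

/-- Neither of the leading terms of `p` and `q` divides the other one. -/
def LeadIncomparable (o : TermOrder α κ) (p q : VecPoly α κ K) : Prop :=
  ¬ TermDvd (o.lt p) (o.lt q) ∧ ¬ TermDvd (o.lt q) (o.lt p)

instance symm_leadIncomparable : Std.Symm (o.LeadIncomparable (K := K)) :=
  ⟨fun _ _ => And.symm⟩

/-- A minimal basis: no zeros, and no leading term divides the leading term of another entry. -/
structure IsMinimalBasis (o : TermOrder α κ) (xs : List (VecPoly α κ K)) : Prop where
  zero_notMem : 0 ∉ xs
  pairwise : xs.Pairwise o.LeadIncomparable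

theorem IsMinimalBasis.perm {xs ys : List (VecPoly α κ K)} (hxs : o.IsMinimalBasis xs)
    (h : xs.Perm ys) : o.IsMinimalBasis ys :=
  ⟨mt h.mem_iff.2 hxs.zero_notMem, (h.pairwise_iff (symm_of _)).1 hxs.pairwise⟩

theorem IsMinimalBasis.leadIncomparable {xs : List (VecPoly α κ K)} (hxs : o.IsMinimalBasis xs)
    {p q : VecPoly α κ K} (hp : p ∈ xs) (hq : q ∈ xs) (hpq : p ≠ q) : o.LeadIncomparable p q :=
  hxs.pairwise.forall hp hq hpq

theorem mem_append_of_mem_filterMinAux {xs ys : List (VecPoly α κ K)} {z : VecPoly α κ K}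
    (hz : z ∈ o.filterMinAux xs ys) : z ∈ xs ++ ys := by
  fun_induction filterMinAux o xs ys with
  | case1 ys => exact hz
  | case2 x xs ys _ ih => exact List.mem_cons_of_mem x (ih hz)
  | case3 x xs ys _ ih => exact List.perm_middle.mem_iff.1 (ih hz)

theorem exists_mem_filterMinAux_termDvd {xs ys : List (VecPoly α κ K)} {x : VecPoly α κ K}
    (hx : x ∈ xs ++ ys) : ∃ z ∈ o.filterMinAux xs ys, TermDvd (o.lt z) (o.lt x) := by
  fun_induction filterMinAux o xs ys generalizing x with
  | case1 ys => exact ⟨x, hx, .refl _⟩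
  | case2 x' xs ys h ih =>
    rcases List.mem_cons.1 hx with rfl | hx
    · obtain ⟨y, hy, hyx⟩ := h
      obtain ⟨z, hz, hzy⟩ := ih hy
      exact ⟨z, hz, hzy.trans hyx⟩
    · exact ih hx
  | case3 x' xs ys _ ih => exact ih (List.perm_middle.mem_iff.2 hx)

theorem pairwise_leadIncomparable_filterMinAux {xs ys : List (VecPoly α κ K)}
    (hys : ys.Pairwise o.LeadIncomparable)
    (hxs : ∀ y ∈ ys, ∀ x ∈ xs, ¬ TermDvd (o.lt x) (o.lt y)) :
    (o.filterMinAux xs ys).Pairwise o.LeadIncomparable := by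
  fun_induction filterMinAux o xs ys with
  | case1 ys => exact hys
  | case2 x xs ys _ ih => exact ih hys fun y hy z hz => hxs y hy z (List.mem_cons_of_mem x hz)
  | case3 x xs ys h ih =>
    push Not at h
    refine ih (hys.cons fun y hy => ?_) (List.forall_mem_cons.2 ⟨fun z hz => ?_, ?_⟩)
    · exact ⟨hxs y hy x List.mem_cons_self, h y (List.mem_append_right xs hy)⟩
    · exact h z (List.mem_append_left ys hz)
    · exact fun y hy z hz => hxs y hy z (List.mem_cons_of_mem x hz)

theorem mem_and_ne_zero_of_mem_compMinBasis {xs : List (VecPoly α κ K)} {z : VecPoly α κ K}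
    (hz : z ∈ o.compMinBasis xs) : z ∈ xs ∧ z ≠ 0 := by
  simpa using mem_append_of_mem_filterMinAux hz

theorem isMinimalBasis_compMinBasis (xs : List (VecPoly α κ K)) :
    o.IsMinimalBasis (o.compMinBasis xs) where
  zero_notMem h := (mem_and_ne_zero_of_mem_compMinBasis h).2 rfl
  pairwise := pairwise_leadIncomparable_filterMinAux .nil (by simp)

theorem dvdCovers_leadTerms_compMinBasis (xs : List (VecPoly α κ K)) :
    DvdCovers (o.leadTerms {x | x ∈ o.compMinBasis xs}) (o.leadTerms {x | x ∈ xs}) := by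
  rintro _ ⟨x, ⟨hx, hx0⟩, rfl⟩
  obtain ⟨z, hz, hdvd⟩ : ∃ z ∈ o.compMinBasis xs, TermDvd (o.lt z) (o.lt x) :=
    exists_mem_filterMinAux_termDvd (by simpa using ⟨hx, hx0⟩)
  exact ⟨_, o.lt_mem_leadTerms hz (mem_and_ne_zero_of_mem_compMinBasis hz).2, hdvd⟩

end MinimalBasis

section ReducedBasis

variable {α κ K : Type*} [AddCommMonoid α] [LinearOrder κ] [Nonempty κ] [Field K]
  {o : TermOrder α κ}

/-- No term of `p` is divisible by a term in `W`, except possibly by the leading term of `p`. In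
this form, auto-reducedness only depends on the leading terms of the basis. -/
def IsTermReduced (o : TermOrder α κ) (W : Set (α × κ)) (p : VecPoly α κ K) : Prop :=
  ∀ w ∈ W, w ≠ o.lt p → ∀ v, coeff p v ≠ 0 → ¬ TermDvd w v

theorem IsMinimalBasis.isAutoReduced {xs : List (VecPoly α κ K)} (hxs : o.IsMinimalBasis xs)
    (h : ∀ x ∈ xs, o.IsTermReduced (o.leadTerms {x | x ∈ xs}) x) :
    o.IsAutoReduced {x | x ∈ xs} := by
  intro b hb hred
  obtain ⟨-, ⟨f, ⟨⟨hf, hfb⟩, hf0⟩, rfl⟩, v, hv, hdvd⟩ := isRed_iff.1 hred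
  refine h b hb _ (o.lt_mem_leadTerms hf hf0) (fun hlt => ?_) v hv hdvd
  exact (hxs.leadIncomparable hf hb hfb).1 (hlt ▸ .refl _)

variable [GradedDicksonPowerprod α] {xs ys zs : List (VecPoly α κ K)} {x : VecPoly α κ K}

theorem IsMinimalBasis.trd_ne_zero_and_lt_trd_eq (h : o.IsMinimalBasis (x :: zs)) :
    o.trd zs x ≠ 0 ∧ o.lt (o.trd zs x) = o.lt x := by
  refine ne_zero_and_lt_eq_of_reflTransGen_red (o.reflTransGen_red_trd zs x)
    (fun hx => h.zero_notMem (hx ▸ List.mem_cons_self)) ?_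
  rintro _ ⟨z, ⟨hz, -⟩, rfl⟩
  exact (List.rel_of_pairwise_cons h.pairwise hz).2

theorem IsMinimalBasis.cons_trd (h : o.IsMinimalBasis (x :: zs)) :
    o.IsMinimalBasis (o.trd zs x :: zs) := by
  obtain ⟨hne, hlt⟩ := h.trd_ne_zero_and_lt_trd_eq
  refine ⟨?_, h.pairwise.of_cons.cons fun z hz => ?_⟩
  · rw [List.mem_cons, not_or]
    exact ⟨hne.symm, fun h0 => h.zero_notMem (List.mem_cons_of_mem x h0)⟩
  · rw [LeadIncomparable, hlt]
    exact List.rel_of_pairwise_cons h.pairwise hz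

theorem IsMinimalBasis.append_trd_cons (h : o.IsMinimalBasis (x :: xs ++ ys)) :
    o.IsMinimalBasis (xs ++ o.trd (xs ++ ys) x :: ys) :=
  (IsMinimalBasis.cons_trd h).perm List.perm_middle.symm

theorem leadTerms_append_trd_cons (h : o.IsMinimalBasis (x :: xs ++ ys)) :
    o.leadTerms {z | z ∈ xs ++ o.trd (xs ++ ys) x :: ys} =
      o.leadTerms {z | z ∈ x :: xs ++ ys} := by
  obtain ⟨hne, hlt⟩ := IsMinimalBasis.trd_ne_zero_and_lt_trd_eq h
  have hx : x ≠ 0 := fun hx => h.zero_notMem (hx ▸ List.mem_cons_self)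
  rw [List.append_eq] at hne hlt
  rw [setOf_mem_append_cons, o.leadTerms_insert _ hne, hlt, ← o.leadTerms_insert _ hx,
    List.cons_append, setOf_mem_cons]

theorem isMinimalBasis_compRedBasisAux (h : o.IsMinimalBasis (xs ++ ys)) :
    o.IsMinimalBasis (o.compRedBasisAux xs ys) := by
  fun_induction compRedBasisAux o xs ys with
  | case1 ys => exact h
  | case2 x xs ys ih => exact ih h.append_trd_cons

theorem leadTerms_compRedBasisAux (h : o.IsMinimalBasis (xs ++ ys)) :
    o.leadTerms {z | z ∈ o.compRedBasisAux xs ys} = o.leadTerms {z | z ∈ xs ++ ys} := by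
  fun_induction compRedBasisAux o xs ys with
  | case1 ys => rfl
  | case2 x xs ys ih => exact (ih h.append_trd_cons).trans (leadTerms_append_trd_cons h)

theorem pmdl_compRedBasisAux (o : TermOrder α κ) (xs ys : List (VecPoly α κ K)) :
    pmdl {z | z ∈ o.compRedBasisAux xs ys} = pmdl {z | z ∈ xs ++ ys} := by
  fun_induction compRedBasisAux o xs ys with
  | case1 ys => rfl
  | case2 x xs ys ih =>
    rw [ih, setOf_mem_append_cons, List.cons_append, setOf_mem_cons]
    exact span_insert_eq_of_sub_mem (o.sub_trd_mem_pmdl (xs ++ ys) x)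

theorem isTermReduced_trd (h : o.IsMinimalBasis (x :: zs)) :
    o.IsTermReduced (o.leadTerms {z | z ∈ x :: zs}) (o.trd zs x) := by
  rintro _ ⟨z, ⟨hz, hz0⟩, rfl⟩ hne v hv hdvd
  rw [h.trd_ne_zero_and_lt_trd_eq.2] at hne
  have hmem : z ∈ zs := (List.mem_cons.1 hz).resolve_left fun hzx => hne (hzx ▸ rfl)
  exact o.not_isRed_trd zs x (isRed_iff.2 ⟨_, o.lt_mem_leadTerms hmem hz0, v, hv, hdvd⟩)

theorem isTermReduced_of_mem_compRedBasisAux (h : o.IsMinimalBasis (xs ++ ys))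
    (hys : ∀ y ∈ ys, o.IsTermReduced (o.leadTerms {z | z ∈ xs ++ ys}) y) {z : VecPoly α κ K}
    (hz : z ∈ o.compRedBasisAux xs ys) :
    o.IsTermReduced (o.leadTerms {z | z ∈ o.compRedBasisAux xs ys}) z := by
  fun_induction compRedBasisAux o xs ys with
  | case1 ys => exact hys z hz
  | case2 x xs ys ih =>
    refine ih h.append_trd_cons ?_ hz
    rw [leadTerms_append_trd_cons h]
    exact List.forall_mem_cons.2 ⟨isTermReduced_trd h, hys⟩

theorem isAutoReduced_compRedBasisAux (h : o.IsMinimalBasis xs) :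
    o.IsAutoReduced {z | z ∈ o.compRedBasisAux xs []} := by
  rw [← List.append_nil xs] at h
  exact (isMinimalBasis_compRedBasisAux h).isAutoReduced fun z hz =>
    isTermReduced_of_mem_compRedBasisAux h (by simp) hz

end ReducedBasis

section Monic

variable {α κ K : Type*} [AddCommMonoid α] [LinearOrder κ] [Nonempty κ] [Field K]
  {o : TermOrder α κ} {F : Set (VecPoly α κ K)} {p : VecPoly α κ K}

theorem monic_zero : o.monic (0 : VecPoly α κ K) = 0 := monomMult_zero_right _ _

theorem monomMult_lc_monic (p : VecPoly α κ K) : monomMult (o.lc p) 0 (o.monic p) = p := by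
  by_cases hp : p = 0
  · rw [hp, monic_zero, monomMult_zero_right]
  · have hlc : o.lc p ≠ 0 := o.coeff_lt_ne_zero hp
    rw [monic, monomMult_monomMult, mul_one_div_cancel hlc, zero_add, monomMult_one_zero]

theorem pmdl_image_monic (o : TermOrder α κ) (F : Set (VecPoly α κ K)) :
    pmdl (o.monic '' F) = pmdl F := by
  refine le_antisymm (Submodule.span_le.2 ?_) (Submodule.span_le.2 fun p hp => ?_)
  · rintro _ ⟨p, hp, rfl⟩
    exact monomMult_mem (Submodule.subset_span hp) _ _
  · rw [← monomMult_lc_monic (o := o) p]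
    exact monomMult_mem (Submodule.subset_span (Set.mem_image_of_mem _ hp)) _ _

variable [IsCancelAdd α]

theorem coeff_monic (p : VecPoly α κ K) (v : α × κ) :
    coeff (o.monic p) v = 1 / o.lc p * coeff p v :=
  coeff_monomMult_zero _ _ _

theorem coeff_monic_ne_zero_iff {v : α × κ} : coeff (o.monic p) v ≠ 0 ↔ coeff p v ≠ 0 := by
  rw [coeff_monic, mul_ne_zero_iff, and_iff_right_of_imp]
  exact fun hv => one_div_ne_zero (o.coeff_lt_ne_zero (ne_zero_of_coeff_ne_zero hv))

theorem monic_eq_zero_iff : o.monic p = 0 ↔ p = 0 := by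
  refine ⟨fun h => ?_, fun h => by rw [h, monic_zero]⟩
  by_contra hp
  exact ne_zero_of_coeff_ne_zero (coeff_monic_ne_zero_iff.2 (o.coeff_lt_ne_zero hp)) h

theorem lt_monic (p : VecPoly α κ K) : o.lt (o.monic p) = o.lt p := by
  by_cases hp : p = 0
  · rw [hp, monic_zero]
  · exact o.lt_eq (coeff_monic_ne_zero_iff.2 (o.coeff_lt_ne_zero hp)) fun _ hw =>
      o.le_lt (coeff_monic_ne_zero_iff.1 hw)

theorem lc_monic (hp : p ≠ 0) : o.lc (o.monic p) = 1 := by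
  rw [lc, lt_monic, coeff_monic]
  exact one_div_mul_cancel (o.coeff_lt_ne_zero hp)

theorem leadTerms_image_monic (F : Set (VecPoly α κ K)) :
    o.leadTerms (o.monic '' F) = o.leadTerms F := by
  ext v
  simp [leadTerms, monic_eq_zero_iff, lt_monic]

theorem IsAutoReduced.image_monic (hF : o.IsAutoReduced F) : o.IsAutoReduced (o.monic '' F) := by
  rintro _ ⟨p, hp, rfl⟩ hred
  obtain ⟨w, hw, v, hv, hdvd⟩ := isRed_iff.1 hred
  have hsub : o.monic '' F \ {o.monic p} ⊆ o.monic '' (F \ {p}) := by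
    rintro _ ⟨⟨q, hq, rfl⟩, hqp⟩
    exact ⟨q, ⟨hq, ne_of_apply_ne o.monic hqp⟩, rfl⟩
  have hw' := o.leadTerms_mono hsub hw
  rw [leadTerms_image_monic] at hw'
  exact hF p hp (isRed_iff.2 ⟨w, hw', v, coeff_monic_ne_zero_iff.1 hv, hdvd⟩)

end Monic

section Algorithm

variable {α κ K : Type*} [AddCommMonoid α] [GradedDicksonPowerprod α] [LinearOrder κ] [Nonempty κ]
  [Field K] {o : TermOrder α κ} {xs : List (VecPoly α κ K)}

theorem setOf_mem_compRedMonicBasis (o : TermOrder α κ) (xs : List (VecPoly α κ K)) :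
    {x | x ∈ o.compRedMonicBasis xs} =
      o.monic '' {x | x ∈ o.compRedBasisAux (o.compMinBasis xs) []} := by
  ext x
  simp [compRedMonicBasis]

theorem pmdl_compRedMonicBasis_eq_pmdl_compMinBasis (o : TermOrder α κ)
    (xs : List (VecPoly α κ K)) :
    pmdl {x | x ∈ o.compRedMonicBasis xs} = pmdl {x | x ∈ o.compMinBasis xs} := by
  rw [setOf_mem_compRedMonicBasis, pmdl_image_monic, pmdl_compRedBasisAux, List.append_nil]

theorem leadTerms_compRedMonicBasis (o : TermOrder α κ) (xs : List (VecPoly α κ K)) :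
    o.leadTerms {x | x ∈ o.compRedMonicBasis xs} = o.leadTerms {x | x ∈ o.compMinBasis xs} := by
  have hmin := o.isMinimalBasis_compMinBasis xs
  rw [← List.append_nil (o.compMinBasis xs)] at hmin
  rw [setOf_mem_compRedMonicBasis, leadTerms_image_monic, leadTerms_compRedBasisAux hmin,
    List.append_nil]

theorem IsGroebnerBasis.dvdCovers_leadTerms_compMinBasis
    (h : o.IsGroebnerBasis {x | x ∈ xs}) :
    DvdCovers (o.leadTerms {x | x ∈ o.compMinBasis xs})
      (o.leadTerms (pmdl {x | x ∈ xs} : Set (VecPoly α κ K))) :=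
  (TermOrder.dvdCovers_leadTerms_compMinBasis xs).trans h.dvdCovers_leadTerms_pmdl

theorem IsGroebnerBasis.pmdl_compRedMonicBasis (h : o.IsGroebnerBasis {x | x ∈ xs}) :
    pmdl {x | x ∈ o.compRedMonicBasis xs} = pmdl {x | x ∈ xs} := by
  rw [pmdl_compRedMonicBasis_eq_pmdl_compMinBasis]
  exact pmdl_eq_of_dvdCovers (List.finite_toSet _)
    (fun x hx => Submodule.subset_span (mem_and_ne_zero_of_mem_compMinBasis hx).1)
    h.dvdCovers_leadTerms_compMinBasis

theorem IsGroebnerBasis.isReducedGB_compRedMonicBasis (h : o.IsGroebnerBasis {x | x ∈ xs}) :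
    o.IsReducedGB {x | x ∈ o.compRedMonicBasis xs} := by
  have hmin := o.isMinimalBasis_compMinBasis xs
  have hne : ∀ x ∈ o.compRedBasisAux (o.compMinBasis xs) [], x ≠ 0 := fun x hx =>
    ne_of_mem_of_not_mem hx (isMinimalBasis_compRedBasisAux (by simpa using hmin)).zero_notMem
  refine ⟨isGroebnerBasis_of_dvdCovers (List.finite_toSet _) ?_, ?_, ?_, ?_⟩
  · rw [leadTerms_compRedMonicBasis, h.pmdl_compRedMonicBasis]
    exact h.dvdCovers_leadTerms_compMinBasis
  · rw [setOf_mem_compRedMonicBasis]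
    exact (isAutoReduced_compRedBasisAux hmin).image_monic
  · rw [setOf_mem_compRedMonicBasis]
    rintro _ ⟨x, hx, rfl⟩
    exact lc_monic (hne x hx)
  · rw [setOf_mem_compRedMonicBasis]
    rintro ⟨x, hx, hx0⟩
    exact hne x hx (monic_eq_zero_iff.1 hx0)

end Algorithm

end TermOrder

section Splitting

variable {α : Type*} {d : α → ℕ} {m : ℕ}

theorem IsDicksonGrading.add_le_iff [Add α] (hd : IsDicksonGrading d) {s t : α} :
    d (s + t) ≤ m ↔ d s ≤ m ∧ d t ≤ m := by
  rw [hd.map_add, max_le_iff]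

theorem IsDicksonGrading.partiallyWellOrderedOn_termDvd [AddCommMonoid α] {κ : Type*}
    (hd : IsDicksonGrading d) (m : ℕ) {C : Set κ} (hC : C.Finite) :
    {v : α × κ | d v.1 ≤ m ∧ v.2 ∈ C}.PartiallyWellOrderedOn TermDvd := by
  intro f
  obtain ⟨i, j, hij, h⟩ := (hd.dickson m).prod (hC.partiallyWellOrderedOn (r := Eq)) f
  exact ⟨i, j, hij, h.symm⟩

variable [AddCommMonoid α]

/-- The power-product `r` has no divisor of degree at most `m` except `0`; for `α = (σ →₀ ℕ)` this
says that no indeterminate of degree at most `m` occurs in `r`. -/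
def DegreeFree (d : α → ℕ) (m : ℕ) (r : α) : Prop := ∀ e, Adds e r → d e ≤ m → e = 0

variable [GradedDicksonPowerprod α]

theorem eq_zero_of_adds_add_self {e z : α} (h : Adds (e + z) z) : e = 0 := by
  obtain ⟨u, hu⟩ := h
  refine GradedDicksonPowerprod.eq_zero_of_add e u (add_right_cancel (b := z) ?_)
  rw [zero_add, add_right_comm, ← hu]

theorem IsDicksonGrading.exists_eq_add_degreeFree (hd : IsDicksonGrading d) (hm : d 0 ≤ m)
    (t : α) : ∃ r s, t = r + s ∧ d s ≤ m ∧ DegreeFree d m r := by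
  have ht : t ∈ {x | d x ≤ d t} := le_refl (d t)
  refine (hd.dickson (d t)).wellFoundedOn.induction
    (P := fun t => ∃ r s, t = r + s ∧ d s ≤ m ∧ DegreeFree d m r) ht fun y hy ih => ?_
  by_cases hfree : DegreeFree d m y
  · exact ⟨y, 0, (add_zero y).symm, hm, hfree⟩
  simp only [DegreeFree, not_forall] at hfree
  obtain ⟨e, ⟨z, rfl⟩, he, he0⟩ := hfree
  obtain ⟨r, s, rfl, hs, hr⟩ := ih z (hd.add_le_iff.1 hy).2
    ⟨⟨e, add_comm e z⟩, fun h => he0 (eq_zero_of_adds_add_self h)⟩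
  exact ⟨r, e + s, add_left_comm e r s, hd.add_le_iff.2 ⟨he, hs⟩, hr⟩

theorem DegreeFree.adds_of_adds_add {r u a : α} (hr : DegreeFree d m r)
    (hd : IsDicksonGrading d) (ha : d a ≤ m) (h : Adds r (u + a)) : Adds r u := by
  obtain ⟨l, ⟨x, rfl⟩, ⟨z, hz⟩, hl⟩ := GradedDicksonPowerprod.exists_lcm r a
  obtain ⟨y, hy⟩ := hl (r + a) ⟨a, rfl⟩ ⟨r, add_comm r a⟩
  obtain rfl : a = x + y := add_left_cancel (hy.trans (add_assoc r x y))
  have hry : r = y + z := by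
    refine add_right_cancel (b := x) ?_
    rw [hz]
    abel
  obtain rfl : y = 0 := hr y ⟨z, hry⟩ (hd.add_le_iff.1 ha).2
  rw [add_zero] at h hl
  obtain ⟨b, hb⟩ := hl (u + x) h ⟨u, add_comm u x⟩
  exact ⟨b, add_right_cancel (hb.trans (add_right_comm r x b))⟩

end Splitting

section Terms

variable {α κ K : Type*} [Field K] {F : Set (VecPoly α κ K)}

/-- The set of terms appearing in elements of `F`. -/
def terms (F : Set (VecPoly α κ K)) : Set (α × κ) := {v | ∃ p ∈ F, coeff p v ≠ 0}

theorem finite_terms [AddCommMonoid α] (hF : F.Finite) : (terms F).Finite := by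
  refine (hF.biUnion fun p _ => (keys p).finite_toSet).subset ?_
  rintro v ⟨p, hp, hv⟩
  exact Set.mem_biUnion hp (mem_keys.2 hv)

theorem snd_mem_of_mem_terms_pmdl [AddCommMonoid α] [IsCancelAdd α] {v : α × κ}
    (hv : v ∈ terms (pmdl F : Set (VecPoly α κ K))) : v.2 ∈ Prod.snd '' terms F := by
  obtain ⟨p, hp, hv⟩ := hv
  revert v
  refine span_induction_of_single_smul
    (P := fun p => ∀ {v}, coeff p v ≠ 0 → v.2 ∈ Prod.snd '' terms F)
    (fun hv => absurd (coeff_zero _) hv)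
    (fun x y hx hy _ hv => (coeff_ne_zero_or_of_coeff_add_ne_zero hv).elim hx hy)
    (fun c t f hf _ hv => ?_) hp
  obtain ⟨w, rfl, hw⟩ := exists_of_coeff_monomMult hv
  exact ⟨w, ⟨f, hf, hw⟩, rfl⟩

end Terms

section Slices

variable {α κ K : Type*} [AddCommMonoid α] [Field K] {d : α → ℕ} {m : ℕ} {r : α}
  {p p' q q' f : VecPoly α κ K}

/-- `q` is the slice of `p` at `r`: the terms of `p` that are multiples of `r` by power-products of
degree at most `m`, divided by `r`. -/
def IsSlice (d : α → ℕ) (m : ℕ) (r : α) (p q : VecPoly α κ K) : Prop :=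
  ∀ v : α × κ, coeff q v = if d v.1 ≤ m then coeff p (r + v.1, v.2) else 0

theorem isSlice_zero (d : α → ℕ) (m : ℕ) (r : α) : IsSlice d m r (0 : VecPoly α κ K) 0 := by
  intro v
  rw [coeff_zero, coeff_zero, ite_self]

theorem IsSlice.add (h : IsSlice d m r p q) (h' : IsSlice d m r p' q') :
    IsSlice d m r (p + p') (q + q') := by
  intro v
  rw [coeff_add, coeff_add, h, h', ite_add_ite, add_zero]

theorem isSlice_monomMult_add [IsCancelAdd α] (hd : IsDicksonGrading d)
    (hf : ∀ v, coeff f v ≠ 0 → d v.1 ≤ m) (c : K) (r : α) {e : α} (he : d e ≤ m) :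
    IsSlice d m r (monomMult c (r + e) f) (monomMult c e f) := by
  intro v
  split_ifs with hv
  · rw [← one_mul c, ← monomMult_monomMult, coeff_monomMult, one_mul, one_mul]
  · by_contra hne
    obtain ⟨w, rfl, hw⟩ := exists_of_coeff_monomMult hne
    exact hv (hd.add_le_iff.2 ⟨he, hf w hw⟩)

variable [GradedDicksonPowerprod α]

theorem isSlice_monomMult_zero_of_forall_ne (hd : IsDicksonGrading d) (hr : DegreeFree d m r)
    (hf : ∀ v, coeff f v ≠ 0 → d v.1 ≤ m) (c : K) {u : α} (hu : ∀ e, d e ≤ m → u ≠ r + e) :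
    IsSlice d m r (monomMult c u f) 0 := by
  intro v
  rw [coeff_zero, eq_comm, ite_eq_right_iff]
  intro hv
  by_contra hne
  obtain ⟨w, hvw, hw⟩ := exists_of_coeff_monomMult hne
  obtain ⟨hvw : r + v.1 = u + w.1, -⟩ := Prod.ext_iff.1 hvw
  obtain ⟨e, rfl⟩ := hr.adds_of_adds_add hd (hf w hw) ⟨v.1, hvw.symm⟩
  have hve : v.1 = e + w.1 := add_left_cancel (hvw.trans (add_assoc r e w.1))
  exact hu e (hd.add_le_iff.1 (hve ▸ hv)).1 rfl

theorem exists_isSlice_of_mem_pmdl (hd : IsDicksonGrading d) (hr : DegreeFree d m r)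
    {F : Set (VecPoly α κ K)} (hF : ∀ v ∈ terms F, d v.1 ≤ m) (hp : p ∈ pmdl F) :
    ∃ q ∈ pmdl F, IsSlice d m r p q := by
  refine span_induction_of_single_smul (P := fun p => ∃ q ∈ pmdl F, IsSlice d m r p q)
    ⟨0, Submodule.zero_mem _, isSlice_zero d m r⟩ ?_ (fun c u f hf => ?_) hp
  · rintro x y ⟨q, hq, hxq⟩ ⟨q', hq', hyq'⟩
    exact ⟨q + q', Submodule.add_mem _ hq hq', hxq.add hyq'⟩
  have hf_le : ∀ v, coeff f v ≠ 0 → d v.1 ≤ m := fun v hv => hF v ⟨f, hf, hv⟩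
  by_cases hu : ∃ e, d e ≤ m ∧ u = r + e
  · obtain ⟨e, he, rfl⟩ := hu
    exact ⟨monomMult c e f, monomMult_mem (Submodule.subset_span hf) c e,
      isSlice_monomMult_add hd hf_le c r he⟩
  · push Not at hu
    exact ⟨0, Submodule.zero_mem _, isSlice_monomMult_zero_of_forall_ne hd hr hf_le c hu⟩

end Slices

namespace TermOrder

section Existence

variable {α κ K : Type*} [AddCommMonoid α] [LinearOrder κ] [Nonempty κ] [Field K]
  {d : α → ℕ} {m : ℕ} {r s : α} {p q : VecPoly α κ K}

theorem ne_zero_and_termDvd_lt_of_isSlice (o : TermOrder α κ) (hpq : IsSlice d m r p q)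
    (hp : p ≠ 0) (hrs : (o.lt p).1 = r + s) (hs : d s ≤ m) :
    q ≠ 0 ∧ d (o.lt q).1 ≤ m ∧ TermDvd (o.lt q) (o.lt p) := by
  have hltp : (r + s, (o.lt p).2) = o.lt p := Prod.ext hrs.symm rfl
  have hqs : coeff q (s, (o.lt p).2) ≠ 0 := by
    rw [hpq, if_pos hs, hltp]
    exact o.coeff_lt_ne_zero hp
  have hq := ne_zero_of_coeff_ne_zero hqs
  have hlc := o.coeff_lt_ne_zero hq
  rw [hpq, ite_ne_right_iff] at hlc
  obtain ⟨hle, hlc⟩ := hlc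
  have hmono := o.stimes_mono _ _ r (o.le_lt hqs)
  rw [hltp] at hmono
  exact ⟨hq, hle, termDvd_iff.2 ⟨r, o.ordT.le_antisymm _ _ hmono (o.le_lt hlc)⟩⟩

variable [GradedDicksonPowerprod α]

theorem dvdCovers_leadTerms_pmdl_degree_le (o : TermOrder α κ) (hd : IsDicksonGrading d)
    (hm : d 0 ≤ m) {F : Set (VecPoly α κ K)} (hF : ∀ v ∈ terms F, d v.1 ≤ m) :
    DvdCovers {w ∈ o.leadTerms (pmdl F : Set (VecPoly α κ K)) | d w.1 ≤ m}
      (o.leadTerms (pmdl F : Set (VecPoly α κ K))) := by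
  rintro _ ⟨p, ⟨hp, hp0⟩, rfl⟩
  obtain ⟨r, s, hrs, hs, hr⟩ := hd.exists_eq_add_degreeFree hm (o.lt p).1
  obtain ⟨q, hq, hpq⟩ := exists_isSlice_of_mem_pmdl hd hr hF hp
  obtain ⟨hq0, hle, hdvd⟩ := o.ne_zero_and_termDvd_lt_of_isSlice hpq hp0 hrs hs
  exact ⟨_, ⟨o.lt_mem_leadTerms hq hq0, hle⟩, hdvd⟩

theorem exists_finite_dvdCovers_leadTerms (o : TermOrder α κ)
    {N : Submodule (AddMonoidAlgebra K α) (VecPoly α κ K)} (hN : N.FG) :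
    ∃ W ⊆ o.leadTerms (N : Set (VecPoly α κ K)), W.Finite ∧
      DvdCovers W (o.leadTerms (N : Set (VecPoly α κ K))) := by
  obtain ⟨F, hF, rfl⟩ := Submodule.fg_def.1 hN
  obtain ⟨d, hd⟩ := GradedDicksonPowerprod.exists_grading (α := α)
  have hfin := finite_terms hF
  obtain ⟨m, hm⟩ := ((hfin.image fun v => d v.1).insert (d 0)).bddAbove
  rw [mem_upperBounds, Set.forall_mem_insert, Set.forall_mem_image] at hm
  have hpwo : {w ∈ o.leadTerms (pmdl F : Set (VecPoly α κ K)) | d w.1 ≤ m}.PartiallyWellOrderedOn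
      TermDvd := by
    refine (hd.partiallyWellOrderedOn_termDvd m (hfin.image Prod.snd)).mono ?_
    rintro _ ⟨⟨p, ⟨hp, hp0⟩, rfl⟩, hle⟩
    exact ⟨hle, snd_mem_of_mem_terms_pmdl ⟨p, hp, o.coeff_lt_ne_zero hp0⟩⟩
  obtain ⟨W, hW, hWfin, hcov⟩ := exists_finite_cover_of_partiallyWellOrderedOn hpwo
  exact ⟨W, hW.trans (Set.sep_subset _ _), hWfin,
    DvdCovers.trans hcov (o.dvdCovers_leadTerms_pmdl_degree_le hd hm.1 hm.2)⟩

theorem exists_finite_isGroebnerBasis (o : TermOrder α κ)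
    {N : Submodule (AddMonoidAlgebra K α) (VecPoly α κ K)} (hN : N.FG) :
    ∃ G : Set (VecPoly α κ K), G.Finite ∧ o.IsGroebnerBasis G ∧ pmdl G = N := by
  obtain ⟨G, hGN, hG, hcov⟩ :=
    Set.exists_subset_image_finite_and.1 (o.exists_finite_dvdCovers_leadTerms hN)
  have hcov' : DvdCovers (o.leadTerms G) (o.leadTerms (N : Set (VecPoly α κ K))) := by
    rwa [leadTerms, Set.sdiff_singleton_eq_self fun h0 => (hGN h0).2 rfl]
  obtain rfl := pmdl_eq_of_dvdCovers hG (hGN.trans Set.sdiff_subset) hcov'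
  exact ⟨G, hG, isGroebnerBasis_of_dvdCovers hG hcov', rfl⟩

theorem existsUnique_isReducedGB (o : TermOrder α κ)
    {N : Submodule (AddMonoidAlgebra K α) (VecPoly α κ K)} (hN : N.FG) :
    ∃! G : Set (VecPoly α κ K), o.IsReducedGB G ∧ pmdl G = N := by
  obtain ⟨G, hfin, hG, rfl⟩ := o.exists_finite_isGroebnerBasis hN
  obtain ⟨xs, rfl⟩ := exists_list_setOf_mem_eq hfin
  refine ⟨_, ⟨hG.isReducedGB_compRedMonicBasis, hG.pmdl_compRedMonicBasis⟩, ?_⟩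
  rintro B ⟨hB, hBN⟩
  exact hB.eq_of_pmdl_eq hG.isReducedGB_compRedMonicBasis
    (hBN.trans hG.pmdl_compRedMonicBasis.symm)

end Existence

end TermOrder

end ModuleGB

theorem mainTheorem4_general {α κ K : Type*} [AddCommMonoid α] [ModuleGB.GradedDicksonPowerprod α]
    [LinearOrder κ] [Nonempty κ] [Field K] (o : ModuleGB.TermOrder α κ) :
    (∀ A B : Set (ModuleGB.VecPoly α κ K), o.IsReducedGB A → o.IsReducedGB B →
      ModuleGB.pmdl A = ModuleGB.pmdl B → A = B) ∧
    (∀ xs : List (ModuleGB.VecPoly α κ K), o.IsGroebnerBasis {x | x ∈ xs} →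
      o.IsReducedGB {x | x ∈ o.compRedMonicBasis xs} ∧
      ModuleGB.pmdl {x | x ∈ o.compRedMonicBasis xs} = ModuleGB.pmdl {x | x ∈ xs}) ∧
    (∀ N : Submodule (AddMonoidAlgebra K α) (ModuleGB.VecPoly α κ K), N.FG →
      ∃! G : Set (ModuleGB.VecPoly α κ K), o.IsReducedGB G ∧ ModuleGB.pmdl G = N) :=
  ⟨fun _ _ hA hB h => hA.eq_of_pmdl_eq hB h,
    fun _ hxs => ⟨hxs.isReducedGB_compRedMonicBasis, hxs.pmdl_compRedMonicBasis⟩,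
    fun _ hN => o.existsUnique_isReducedGB hN⟩

theorem mainTheorem4 {α κ K : Type*} [AddCommMonoid α] [ModuleGB.GradedDicksonPowerprod α]
    [LinearOrder κ] [WellFoundedLT κ] [Nonempty κ] [Field K] (o : ModuleGB.TermOrder α κ) :
    (∀ A B : Set (ModuleGB.VecPoly α κ K), o.IsReducedGB A → o.IsReducedGB B →
      ModuleGB.pmdl A = ModuleGB.pmdl B → A = B) ∧
    (∀ xs : List (ModuleGB.VecPoly α κ K), o.IsGroebnerBasis {x | x ∈ xs} →
      o.IsReducedGB {x | x ∈ o.compRedMonicBasis xs} ∧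
      ModuleGB.pmdl {x | x ∈ o.compRedMonicBasis xs} = ModuleGB.pmdl {x | x ∈ xs}) ∧
    (∀ N : Submodule (AddMonoidAlgebra K α) (ModuleGB.VecPoly α κ K), N.FG →
      ∃! G : Set (ModuleGB.VecPoly α κ K), o.IsReducedGB G ∧ ModuleGB.pmdl G = N) :=
  mainTheorem4_general o
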